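/- **The Flat Quadrilateral Theorem.** Let $(X,d)$ be a CAT(0) space, i.e. a geodesic metric space in which every geodesic triangle satisfies the CAT(0)-inequality: distances between points of the triangle are at most the distances between the corresponding points of a comparison triangle in the Euclidean plane $\mathbb{E}^2$ (a triangle with the same side lengths). For $x,y,z\in X$ with $y\ne x\ne z$, let $\overline{\angle}_x(y,z)$ denote the comparison angle, i.e. the angle at $\overline{x}$ in a comparison triangle $\overline{x},\overline{y},\overline{z}\in\mathbb{E}^2$ for $x,y,z$. The convex hull of a subset $A\subseteq X$ is the intersection of all closed geodesically convex subsets of $X$ containing $A$, where a subset is geodesically convex if any two of its points are joined by a geodesic contained in it. Let $p,q,r,s\in X$ be points with $p\ne q$, $q\ne r$, $r\ne s$, $s\ne p$, and let $$\alpha=\overline{\angle}_p(s,q),\quad \beta=\overline{\angle}_q(p,r),\quad \gamma=\overline{\angle}_r(q,s),\quad \delta=\overline{\angle}_s(r,p).$$ If $\alpha+\beta+\gamma+\delta\ge 2\pi$, then $\alpha+\beta+\gamma+\delta=2\pi$, and the convex hull of $\{p,q,r,s\}$ in $X$ is isometric to a (possibly degenerate) convex quadrilateral in $\mathbb{E}^2$.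 More precisely, there are points $p',q',r',s'\in\mathbb{E}^2$ whose diagonals $[p',r']$ and $[q',s']$ intersect, and an isometry from the convex hull of $\{p',q',r',s'\}$ in $\mathbb{E}^2$ onto the convex hull of $\{p,q,r,s\}$ in $X$ that maps $p',q',r',s'$ to $p,q,r,s$, respectively. -/

import Mathlib

/-- The Euclidean plane. -/
abbrev EPlane : Type := EuclideanSpace ℝ (Fin 2)

/-- `γ`, restricted to `[0, 1]`, is a geodesic from `x` to `y`, parametrized proportionally to arc
length: `d (γ s, γ t) = c |s - t|` for a constant speed `c`. -/
def IsGeodesicPath {X : Type*} [MetricSpace X] (γ : ℝ → X) (x y : X) : Prop :=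
  γ 0 = x ∧ γ 1 = y ∧
    ∃ c : ℝ, ∀ s ∈ Set.Icc (0 : ℝ) 1, ∀ t ∈ Set.Icc (0 : ℝ) 1, dist (γ s) (γ t) = c * |s - t|

/-- `S` is (the image of) a geodesic segment with endpoints `x` and `y`. -/
def IsGeodesicSegment {X : Type*} [MetricSpace X] (S : Set X) (x y : X) : Prop :=
  ∃ γ : ℝ → X, IsGeodesicPath γ x y ∧ S = γ '' Set.Icc (0 : ℝ) 1

/-- Any two points are joined by a geodesic. -/
def IsGeodesicSpace (X : Type*) [MetricSpace X] : Prop :=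
  ∀ x y : X, ∃ S : Set X, IsGeodesicSegment S x y

/-- `x'`, `y'`, `z'` are the vertices of a comparison triangle in the plane for the points `x`, `y`,
`z`. -/
def IsComparisonTriangle {X : Type*} [MetricSpace X] (x y z : X) (x' y' z' : EPlane) : Prop :=
  dist x' y' = dist x y ∧ dist y' z' = dist y z ∧ dist z' x' = dist z x

/-- Comparison triangles exist. -/
theorem exists_comparisonTriangle {X : Type*} [MetricSpace X] (x y z : X) :
    ∃ T : EPlane × EPlane × EPlane, IsComparisonTriangle x y z T.1 T.2.1 T.2.2 := by
  have h1 := dist_triangle x y z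
  have h2 := dist_triangle y x z
  have h3 := dist_triangle x z y
  have e1 := dist_comm y x
  have e2 := dist_comm z y
  have e3 := dist_comm z x
  have p1 : 0 ≤ dist x y := dist_nonneg
  have p2 : 0 ≤ dist y z := dist_nonneg
  have p3 : 0 ≤ dist x z := dist_nonneg
  unfold IsComparisonTriangle
  rw [e3]
  generalize ha : dist x y = a at *
  generalize hb : dist y z = b at *
  generalize hc : dist x z = c at *
  rcases eq_or_lt_of_le p1 with h0 | h0
  · refine ⟨(!₂[0, 0], !₂[0, 0], !₂[c, 0]), ?_, ?_, ?_⟩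
    · simp [← h0]
    · simp [EuclideanSpace.dist_eq, Fin.sum_univ_two, Real.sqrt_sq_eq_abs]
      rw [abs_of_nonneg p3]; linarith
    · simp [EuclideanSpace.dist_eq, Fin.sum_univ_two, Real.sqrt_sq_eq_abs, abs_of_nonneg p3]
  · set u : ℝ := (a ^ 2 + c ^ 2 - b ^ 2) / (2 * a) with hu
    have hua : 2 * a * u = a ^ 2 + c ^ 2 - b ^ 2 := by rw [hu]; field_simp
    have hv : 0 ≤ c ^ 2 - u ^ 2 := by
      have k1 : u ≤ c := by
        rw [hu, div_le_iff₀ (by positivity)]; nlinarith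
      have k2 : -c ≤ u := by
        rw [hu, le_div_iff₀ (by positivity)]; nlinarith
      nlinarith
    refine ⟨(!₂[0, 0], !₂[a, 0], !₂[u, √(c ^ 2 - u ^ 2)]), ?_, ?_, ?_⟩
    · simp [EuclideanSpace.dist_eq, Fin.sum_univ_two, Real.sqrt_sq_eq_abs, abs_of_nonneg p1]
    · simp only [EuclideanSpace.dist_eq, Fin.sum_univ_two, Real.dist_eq, sq_abs]
      rw [Real.sqrt_eq_iff_mul_self_eq (by positivity) p2]
      simp [Real.sq_sqrt hv]
      nlinarith
    · simp only [EuclideanSpace.dist_eq, Fin.sum_univ_two, Real.dist_eq, sq_abs]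
      rw [Real.sqrt_eq_iff_mul_self_eq (by positivity) p3]
      simp [Real.sq_sqrt hv]
      nlinarith

/-- The comparison angle between `y` and `z` at `x`: the angle at `x'` of a comparison triangle
`x'`, `y'`, `z'` for `x`, `y`, `z`. (It is only used for `y ≠ x` and `z ≠ x`.) -/
noncomputable def comparisonAngle {X : Type*} [MetricSpace X] (x y z : X) : ℝ :=
  EuclideanGeometry.angle (exists_comparisonTriangle x y z).choose.2.1
    (exists_comparisonTriangle x y z).choose.1 (exists_comparisonTriangle x y z).choose.2.2

/-- The comparison angle can be computed in any comparison triangle. -/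
theorem comparisonAngle_eq {X : Type*} [MetricSpace X] {x y z : X} {x' y' z' : EPlane}
    (h : IsComparisonTriangle x y z x' y' z') :
    comparisonAngle x y z = EuclideanGeometry.angle y' x' z' := by
  have key : ∀ a b c : EPlane, EuclideanGeometry.angle b a c =
      Real.arccos ((dist a b ^ 2 + dist c a ^ 2 - dist b c ^ 2) / 2 / (dist a b * dist c a)) := by
    intro a b c
    unfold EuclideanGeometry.angle InnerProductGeometry.angle
    rw [real_inner_eq_norm_mul_self_add_norm_mul_self_sub_norm_sub_mul_self_div_two]
    simp only [vsub_eq_sub, sub_sub_sub_cancel_right, ← dist_eq_norm, dist_comm b a, ← sq]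
  obtain ⟨h1, h2, h3⟩ := h
  obtain ⟨g1, g2, g3⟩ := (exists_comparisonTriangle x y z).choose_spec
  unfold comparisonAngle
  rw [key, key, g1, g2, g3, h1, h2, h3]

/-- A geodesic triangle: three vertices together with a choice of three geodesic sides. -/
structure GeodesicTriangle (X : Type*) [MetricSpace X] where
  x : X
  y : X
  z : X
  xy : Set X
  yz : Set X
  zx : Set X
  isGeodesicSegment_xy : IsGeodesicSegment xy x y
  isGeodesicSegment_yz : IsGeodesicSegment yz y z
  isGeodesicSegment_zx : IsGeodesicSegment zx z x

/-- `p'` on the Euclidean segment from `x'` to `y'` is the comparison point of the point `p` on the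
side `S` from `x` to `y`. -/
def IsSideComparisonPoint {X : Type*} [MetricSpace X] (S : Set X) (x : X) (x' y' : EPlane)
    (p : X) (p' : EPlane) : Prop :=
  p ∈ S ∧ p' ∈ segment ℝ x' y' ∧ dist x' p' = dist x p

/-- `p'` is a comparison point, on the triangle with vertices `x'`, `y'`, `z'`, of the point `p` of
the geodesic triangle `T`. -/
def GeodesicTriangle.IsComparisonPoint {X : Type*} [MetricSpace X] (T : GeodesicTriangle X)
    (x' y' z' : EPlane) (p : X) (p' : EPlane) : Prop :=
  IsSideComparisonPoint T.xy T.x x' y' p p' ∨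
    IsSideComparisonPoint T.yz T.y y' z' p p' ∨
      IsSideComparisonPoint T.zx T.z z' x' p p'

/-- The CAT(0)-inequality for a geodesic triangle. -/
def GeodesicTriangle.SatisfiesCATZero {X : Type*} [MetricSpace X] (T : GeodesicTriangle X) : Prop :=
  ∀ x' y' z' : EPlane, IsComparisonTriangle T.x T.y T.z x' y' z' →
    ∀ (p q : X) (p' q' : EPlane), T.IsComparisonPoint x' y' z' p p' →
      T.IsComparisonPoint x' y' z' q q' → dist p q ≤ dist p' q'

/-- A CAT(0) space: a geodesic metric space all of whose geodesic triangles satisfy the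
CAT(0)-inequality. -/
structure IsCATZeroSpace (X : Type*) [MetricSpace X] : Prop where
  isGeodesicSpace : IsGeodesicSpace X
  satisfiesCATZero : ∀ T : GeodesicTriangle X, T.SatisfiesCATZero

/-- Any two points of `C` are joined by a geodesic contained in `C`. -/
def IsGeodesicallyConvex {X : Type*} [MetricSpace X] (C : Set X) : Prop :=
  ∀ x ∈ C, ∀ y ∈ C, ∃ S : Set X, IsGeodesicSegment S x y ∧ S ⊆ C

/-- The convex hull of `A`: the intersection of all closed geodesically convex sets containing
`A`. -/
def geodesicHull {X : Type*} [MetricSpace X] (A : Set X) : Set X :=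
  ⋂₀ {C : Set X | IsClosed C ∧ IsGeodesicallyConvex C ∧ A ⊆ C}

/-- `a`, `b`, `c`, `d` are, in this cyclic order, the vertices of a convex quadrilateral in the
plane: the diagonals `[a, c]` and `[b, d]` meet. Degenerate quadrilaterals (three or all four
vertices collinear, opposite vertices equal) are allowed. -/
def IsConvexQuadrilateral (a b c d : EPlane) : Prop :=
  (segment ℝ a c ∩ segment ℝ b d).Nonempty

/-!
The proof reduces the theorem to a statement about four points, and then shows flatness by using a
single equality case of the CAT(0)-inequality.

**Four points.** A quadrilateral in a CAT(0) space has a convex comparison quadrilateral in the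
plane with the same sides and with diagonals that are at least as long
(`IsCATZeroSpace.exists_convexQuadrilateral`): glue the comparison triangles along one diagonal. If
the result is convex, the CAT(0)-inequality at the crossing point of the diagonals bounds the other
diagonal; if it has a reflex angle, straighten that angle (`exists_triangle_of_reflex`). Comparison
angles grow with the opposite side, so the four given angles are at most those of the comparison
quadrilateral, whose sum is at most `2π`. A sum of at least `2π` forces equality everywhere, hence
the diagonals agree too, and the four points are isometric to the vertices of the quadrilateral.

**Flatness.** Consider pairs of a point of the plane and a point of `X`, and call two pairs tight if
their distances in the plane and in `X` agree, short if the distance in `X` is at most that in the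
plane. If a pair is short to the ends of a tight segment and tight to an interior point of it, then
the CAT(0)-inequality is an equality and the pair is tight to the ends
(`IsCATZeroSpace.isTight_of_lineMap`). Apply this three times. At the point where the diagonals
meet, it shows that the two diagonals form an isometric copy of a planar cross
(`IsFlatCross.isTight`). Every point of the quadrilateral lies on a segment between the diagonals;
mapping these segments to geodesics gives points that are short to each other, and the rigidity step
at an end of such a segment shows that they are tight to the cross (`IsJoinPoint.isTight_left`).
Finally, for two such points `Y` and `Z`, join `Z` to the far end of one diagonal so that the other
one is crossed: `Y` is tight to the crossing point, hence to `Z` (`IsJoinPoint.isTight`). The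
resulting isometric map has a compact, geodesically convex image, generated by geodesics from the
four points, so the image is their convex hull.
-/

/-! ### Division points of geodesics in a CAT(0) space -/

/-- **Stewart's identity** for a point dividing a segment in the ratio `t : 1 - t`. -/
theorem dist_sq_lineMap_eq {V : Type*} [NormedAddCommGroup V] [InnerProductSpace ℝ V]
    (x y z : V) (t : ℝ) :
    dist z (AffineMap.lineMap x y t) ^ 2 =
      (1 - t) * dist z x ^ 2 + t * dist z y ^ 2 - t * (1 - t) * dist x y ^ 2 := by
  have h1 : z - AffineMap.lineMap x y t = (1 - t) • (z - x) + t • (z - y) := by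
    rw [AffineMap.lineMap_apply_module]; module
  have h2 : x - y = (z - y) - (z - x) := by abel
  rw [dist_eq_norm, dist_eq_norm, dist_eq_norm, dist_eq_norm, h1, h2, norm_add_sq_real,
    norm_sub_sq_real (z - y), norm_smul, norm_smul, mul_pow, mul_pow, Real.norm_eq_abs,
    Real.norm_eq_abs, sq_abs, sq_abs, real_inner_smul_left, real_inner_smul_right,
    real_inner_comm (z - x)]
  ring

/-- `w` divides a geodesic from `x` to `y` in the ratio `t : 1 - t`, as far as distances can tell.
In a CAT(0) space there is exactly one such point for each `t` in `[0, 1]`. -/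
def IsDivPoint {X : Type*} [MetricSpace X] (x y : X) (t : ℝ) (w : X) : Prop :=
  dist x w = t * dist x y ∧ dist w y = (1 - t) * dist x y

theorem IsGeodesicPath.dist_eq {X : Type*} [MetricSpace X] {γ : ℝ → X} {x y : X}
    (h : IsGeodesicPath γ x y) {s t : ℝ} (hs : s ∈ Set.Icc (0 : ℝ) 1)
    (ht : t ∈ Set.Icc (0 : ℝ) 1) : dist (γ s) (γ t) = |s - t| * dist x y := by
  obtain ⟨h0, h1, c, hc⟩ := h
  have h := hc 0 (by simp) 1 (by simp)
  rw [h0, h1] at h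
  rw [hc s hs t ht, h]
  simp [mul_comm]

theorem IsGeodesicPath.isDivPoint {X : Type*} [MetricSpace X] {γ : ℝ → X} {x y : X}
    (h : IsGeodesicPath γ x y) {t : ℝ} (ht : t ∈ Set.Icc (0 : ℝ) 1) :
    IsDivPoint x y t (γ t) := by
  have h0 := h.dist_eq (s := 0) (by simp) ht
  have h1 := h.dist_eq ht (t := 1) (by simp)
  rw [h.1, zero_sub, abs_neg, abs_of_nonneg ht.1] at h0
  rw [h.2.1, abs_sub_comm, abs_of_nonneg (sub_nonneg.2 ht.2)] at h1
  exact ⟨h0, h1⟩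

theorem IsCATZeroSpace.exists_isGeodesicPath {X : Type*} [MetricSpace X] (hX : IsCATZeroSpace X)
    (x y : X) : ∃ γ : ℝ → X, IsGeodesicPath γ x y := by
  obtain ⟨S, γ, h, -⟩ := hX.isGeodesicSpace x y
  exact ⟨γ, h⟩

theorem IsCATZeroSpace.dist_sq_path_le {X : Type*} [MetricSpace X] (hX : IsCATZeroSpace X)
    {x y : X} {γ : ℝ → X} (h : IsGeodesicPath γ x y) {t : ℝ} (ht : t ∈ Set.Icc (0 : ℝ) 1) (z : X) :
    dist z (γ t) ^ 2 ≤ (1 - t) * dist z x ^ 2 + t * dist z y ^ 2 - t * (1 - t) * dist x y ^ 2 := by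
  obtain ⟨S, hS⟩ := hX.isGeodesicSpace y z
  obtain ⟨S', hS'⟩ := hX.isGeodesicSpace z x
  obtain ⟨⟨x', y', z'⟩, hc⟩ := exists_comparisonTriangle x y z
  have hz : z ∈ S := by
    obtain ⟨γ', hγ', rfl⟩ := hS
    exact ⟨1, by simp, hγ'.2.1⟩
  have key := hX.satisfiesCATZero ⟨x, y, z, γ '' Set.Icc 0 1, S, S', ⟨γ, h, rfl⟩, hS, hS'⟩ x' y' z'
    hc z (γ t) z' (AffineMap.lineMap x' y' t)
    (Or.inr (Or.inl ⟨hz, right_mem_segment ℝ y' z', hc.2.1⟩))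
    (Or.inl ⟨⟨t, ht, rfl⟩, by rw [segment_eq_image_lineMap]; exact ⟨t, ht, rfl⟩, by
      show _ = dist x (γ t)
      rw [dist_left_lineMap, hc.1, (h.isDivPoint ht).1, Real.norm_of_nonneg ht.1]⟩)
  have h2 := dist_sq_lineMap_eq x' y' z' t
  rw [dist_comm z' y', hc.1, hc.2.1, hc.2.2, dist_comm y z] at h2
  rw [← h2]
  gcongr

/-- Points with the distances of a division point lie on the geodesic, so the CAT(0)-inequality
for the distance from a vertex to the opposite side applies to them. -/
theorem IsCATZeroSpace.eq_of_isDivPoint {X : Type*} [MetricSpace X] (hX : IsCATZeroSpace X)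
    {x y w : X} {γ : ℝ → X} (h : IsGeodesicPath γ x y) {t : ℝ} (ht : t ∈ Set.Icc (0 : ℝ) 1)
    (hw : IsDivPoint x y t w) : w = γ t := by
  have h1 := hX.dist_sq_path_le h ht w
  rw [dist_comm w x, hw.1, hw.2] at h1
  have h2 : dist w (γ t) ^ 2 ≤ 0 := h1.trans (le_of_eq (by ring))
  exact dist_eq_zero.1 (pow_eq_zero_iff (two_ne_zero) |>.1 (le_antisymm h2 (sq_nonneg _)))

theorem IsCATZeroSpace.dist_sq_le {X : Type*} [MetricSpace X] (hX : IsCATZeroSpace X)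
    {x y w : X} {t : ℝ} (ht : t ∈ Set.Icc (0 : ℝ) 1) (hw : IsDivPoint x y t w) (z : X) :
    dist z w ^ 2 ≤ (1 - t) * dist z x ^ 2 + t * dist z y ^ 2 - t * (1 - t) * dist x y ^ 2 := by
  obtain ⟨γ, h⟩ := hX.exists_isGeodesicPath x y
  rw [hX.eq_of_isDivPoint h ht hw]
  exact hX.dist_sq_path_le h ht z

/-! ### Comparison quadrilaterals -/

theorem EPlane.dist_mk (a b c d : ℝ) :
    dist (!₂[a, b] : EPlane) !₂[c, d] = √((a - c) ^ 2 + (b - d) ^ 2) := by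
  simp [EuclideanSpace.dist_eq, Fin.sum_univ_two, Real.dist_eq, sq_abs]

theorem EPlane.dist_mk_eq {a b c d e : ℝ} (he : 0 ≤ e) (h : (a - c) ^ 2 + (b - d) ^ 2 = e ^ 2) :
    dist (!₂[a, b] : EPlane) !₂[c, d] = e := by
  rw [EPlane.dist_mk, h, Real.sqrt_sq he]

theorem EPlane.mk_congr {a b c d : ℝ} (h : a = c) (h' : b = d) :
    (!₂[a, b] : EPlane) = !₂[c, d] := by
  rw [h, h']

theorem EPlane.lineMap_mk (a b c d t : ℝ) :
    AffineMap.lineMap (!₂[a, b] : EPlane) !₂[c, d] t =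
      !₂[(1 - t) * a + t * c, (1 - t) * b + t * d] := by
  rw [AffineMap.lineMap_apply_module]
  ext i
  fin_cases i <;> simp

/-- If two triangles with sides `P`, `t`, `a` and `Q`, `t`, `b`, glued along the side of length `t`,
have an angle larger than `π` between the sides `a` and `b`, then a triangle with sides `P`, `Q`,
`a + b` exists, and in it the point dividing the side `a + b` is at distance at least `t` from the
opposite vertex (Alexandrov's lemma). -/
theorem exists_triangle_of_reflex {P Q a b t : ℝ} (hP : 0 ≤ P) (hQ : 0 ≤ Q) (ha : 0 < a)
    (hb : 0 < b) (hPa : |P - a| ≤ t) (hQb : |Q - b| ≤ t) (hPQ : P ≤ a + b + Q)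
    (hQP : Q ≤ a + b + P) (h : b * (t ^ 2 + a ^ 2 - P ^ 2) + a * (t ^ 2 + b ^ 2 - Q ^ 2) < 0) :
    ∃ p q r s : EPlane, s ∈ segment ℝ p r ∧ dist p q = P ∧ dist q r = Q ∧ dist r s = b ∧
      dist s p = a ∧ dist p r = a + b ∧ t ≤ dist q s := by
  have h1 : (P - a) ^ 2 ≤ t ^ 2 := sq_le_sq' (by linarith [abs_le.1 hPa]) (abs_le.1 hPa).2
  have h2 : (Q - b) ^ 2 ≤ t ^ 2 := sq_le_sq' (by linarith [abs_le.1 hQb]) (abs_le.1 hQb).2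
  have hab : 0 < a * b := by positivity
  have hc : a + b ≤ P + Q := by
    have h3 : b * (P - a) ^ 2 ≤ b * t ^ 2 := by gcongr
    have h4 : a * (Q - b) ^ 2 ≤ a * t ^ 2 := by gcongr
    have h5 : a * b * (a + b) < a * b * (P + Q) := by nlinarith
    exact (lt_of_mul_lt_mul_left h5 hab.le).le
  -- The side of length `a + b` lies on the first axis, with the division point at the origin.
  set x : ℝ := (P ^ 2 - Q ^ 2 - a ^ 2 + b ^ 2) / (2 * (a + b)) with hx
  have hxe : 2 * (a + b) * x = P ^ 2 - Q ^ 2 - a ^ 2 + b ^ 2 := by rw [hx]; field_simp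
  have hxa : 2 * (a + b) * (x + a) = P ^ 2 - Q ^ 2 + (a + b) ^ 2 := by linarith
  have hk1 : x + a ≤ P := by
    have : 2 * (a + b) * (x + a) ≤ 2 * (a + b) * P := by
      nlinarith [mul_nonneg (sub_nonneg.2 hc) (sub_nonneg.2 hPQ)]
    exact le_of_mul_le_mul_left this (by positivity)
  have hk2 : -P ≤ x + a := by
    have : 2 * (a + b) * (-P) ≤ 2 * (a + b) * (x + a) := by nlinarith
    exact le_of_mul_le_mul_left this (by positivity)
  have hy : 0 ≤ P ^ 2 - (x + a) ^ 2 := by nlinarith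
  have hys := Real.sq_sqrt hy
  refine ⟨!₂[-a, 0], !₂[x, √(P ^ 2 - (x + a) ^ 2)], !₂[b, 0], !₂[0, 0], ?_, ?_, ?_, ?_, ?_, ?_, ?_⟩
  · rw [segment_eq_image_lineMap]
    refine ⟨a / (a + b), ⟨by positivity, (div_le_one (by positivity)).2 (by linarith)⟩, ?_⟩
    rw [EPlane.lineMap_mk]
    refine EPlane.mk_congr ?_ ?_
    · field_simp; ring
    · simp
  · exact EPlane.dist_mk_eq hP (by rw [zero_sub, neg_sq, hys]; ring)
  · exact EPlane.dist_mk_eq hQ (by rw [sub_zero, hys]; linarith)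
  · exact EPlane.dist_mk_eq hb.le (by ring)
  · exact EPlane.dist_mk_eq ha.le (by ring)
  · exact EPlane.dist_mk_eq (by positivity) (by ring)
  · rw [EPlane.dist_mk]
    refine Real.le_sqrt_of_sq_le ?_
    rw [sub_zero, sub_zero, hys]
    have : (a + b) * t ^ 2 ≤ (a + b) * (x ^ 2 + (P ^ 2 - (x + a) ^ 2)) := by nlinarith
    exact le_of_mul_le_mul_left this (by positivity)

/-- A point `(x₁, y₁)` above and a point `(x₂, -y₂)` below the first axis, at distances `P`, `Q`
from the origin: if the angle between them, measured through the positive half-axis, is at most `π`,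
then the segment between them does not cross the negative half-axis. -/
theorem mul_add_mul_nonneg_of_angle_le_pi {x₁ y₁ x₂ y₂ P Q : ℝ} (hP : 0 < P) (hQ : 0 < Q)
    (hy₁ : 0 ≤ y₁) (hy₂ : 0 ≤ y₂) (h₁ : x₁ ^ 2 + y₁ ^ 2 = P ^ 2) (h₂ : x₂ ^ 2 + y₂ ^ 2 = Q ^ 2)
    (h : 0 ≤ Q * x₁ + P * x₂) : 0 ≤ x₁ * y₂ + x₂ * y₁ := by
  -- The interesting case is that of abscissae of opposite signs: `Q x₁ ≥ -P x₂ ≥ 0`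
  -- squares to `x₁ y₂ ≥ -x₂ y₁`.
  have key : ∀ {x₁ y₁ x₂ y₂ P Q : ℝ}, 0 < P → 0 < Q → 0 ≤ y₁ → 0 ≤ y₂ →
      x₁ ^ 2 + y₁ ^ 2 = P ^ 2 → x₂ ^ 2 + y₂ ^ 2 = Q ^ 2 → 0 ≤ Q * x₁ + P * x₂ → 0 ≤ x₁ →
      x₂ ≤ 0 → 0 ≤ x₁ * y₂ + x₂ * y₁ := by
    intro x₁ y₁ x₂ y₂ P Q hP hQ hy₁ hy₂ h₁ h₂ h hx₁ hx₂
    have h3 : (-(P * x₂)) ^ 2 ≤ (Q * x₁) ^ 2 :=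
      pow_le_pow_left₀ (by nlinarith) (by linarith) 2
    have h4 : (-(x₂ * y₁)) ^ 2 ≤ (x₁ * y₂) ^ 2 := by
      have e1 : (-(P * x₂)) ^ 2 = x₂ ^ 2 * (x₁ ^ 2 + y₁ ^ 2) := by rw [h₁]; ring
      have e2 : (Q * x₁) ^ 2 = x₁ ^ 2 * (x₂ ^ 2 + y₂ ^ 2) := by rw [h₂]; ring
      nlinarith
    linarith [le_of_sq_le_sq h4 (by positivity)]
  rcases le_total 0 x₁ with hx₁ | hx₁ <;> rcases le_total 0 x₂ with hx₂ | hx₂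
  · positivity
  · exact key hP hQ hy₁ hy₂ h₁ h₂ h hx₁ hx₂
  · have := key hQ hP hy₂ hy₁ h₂ h₁ (by linarith) hx₂ hx₁
    linarith
  · have hx₁' : x₁ = 0 := by
      refine le_antisymm hx₁ ?_
      have : 0 ≤ Q * x₁ := by nlinarith
      exact nonneg_of_mul_nonneg_right this hQ
    have hx₂' : x₂ = 0 := by
      refine le_antisymm hx₂ ?_
      have : 0 ≤ P * x₂ := by nlinarith
      exact nonneg_of_mul_nonneg_right this hP
    simp [hx₁', hx₂']

/-- The segment from `(x₁, y₁)` to `(x₂, -y₂)` meets `[0, t] × {0}` if the quadrilateral with these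
four vertices has no angle larger than `π` at `(0, 0)` and at `(t, 0)`. -/
theorem exists_crossing {x₁ y₁ x₂ y₂ P Q a b t : ℝ} (ht : 0 ≤ t) (hP : 0 < P) (hQ : 0 < Q)
    (ha : 0 < a) (hb : 0 < b) (hy₁ : 0 ≤ y₁) (hy₂ : 0 ≤ y₂) (h₁ : x₁ ^ 2 + y₁ ^ 2 = P ^ 2)
    (h₂ : x₂ ^ 2 + y₂ ^ 2 = Q ^ 2) (h₃ : (t - x₁) ^ 2 + y₁ ^ 2 = a ^ 2)
    (h₄ : (t - x₂) ^ 2 + y₂ ^ 2 = b ^ 2) (h : 0 ≤ Q * x₁ + P * x₂)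
    (h' : 0 ≤ b * (t - x₁) + a * (t - x₂)) :
    ∃ u ∈ Set.Icc (0 : ℝ) 1, (1 - u) * y₁ + u * (-y₂) = 0 ∧
      0 ≤ (1 - u) * x₁ + u * x₂ ∧ (1 - u) * x₁ + u * x₂ ≤ t := by
  have k1 := mul_add_mul_nonneg_of_angle_le_pi hP hQ hy₁ hy₂ h₁ h₂ h
  have k2 := mul_add_mul_nonneg_of_angle_le_pi ha hb hy₁ hy₂ h₃ h₄ h'
  rcases (add_nonneg hy₁ hy₂).lt_or_eq with hy | hy
  · have e : ∀ z w : ℝ, (1 - y₁ / (y₁ + y₂)) * z + y₁ / (y₁ + y₂) * w =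
        (z * y₂ + w * y₁) / (y₁ + y₂) := by intro z w; field_simp; ring
    refine ⟨y₁ / (y₁ + y₂), ⟨by positivity, (div_le_one hy).2 (by linarith)⟩, ?_, ?_, ?_⟩
    · rw [e]; ring
    · rw [e]; positivity
    · rw [e, div_le_iff₀ hy]; linarith
  · -- All four points are on the first axis.
    obtain rfl : y₁ = 0 := by linarith
    obtain rfl : y₂ = 0 := by linarith
    simp only [mul_zero, neg_zero, add_zero, true_and]
    by_cases c1 : x₁ < 0
    · have c2 : 0 ≤ x₂ := by
        by_contra c2
        nlinarith
      refine ⟨-x₁ / (x₂ - x₁), ⟨div_nonneg (by linarith) (by linarith),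
        (div_le_one (by linarith)).2 (by linarith)⟩, ?_⟩
      have e : (1 - -x₁ / (x₂ - x₁)) * x₁ + -x₁ / (x₂ - x₁) * x₂ = 0 := by
        have : x₂ - x₁ ≠ 0 := by linarith
        field_simp
        ring
      rw [e]
      exact ⟨le_rfl, ht⟩
    · by_cases c3 : t < x₁
      · have c2 : x₂ ≤ t := by
          by_contra c2
          nlinarith
        have c4 : x₁ - x₂ ≠ 0 := by linarith
        refine ⟨(x₁ - t) / (x₁ - x₂), ⟨div_nonneg (by linarith) (by linarith),
          (div_le_one (by linarith)).2 (by linarith)⟩, ?_⟩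
        have e : (1 - (x₁ - t) / (x₁ - x₂)) * x₁ + (x₁ - t) / (x₁ - x₂) * x₂ = t := by
          field_simp
          ring
        rw [e]
        exact ⟨ht, le_rfl⟩
      · exact ⟨0, by simp, by simpa using c1, by simpa using c3⟩

/-- Vertices of comparison triangles glued along a common side `[q', s']` satisfy
`d(p, r) ≤ d(p', r')` if the diagonals meet: compare through the crossing point. -/
theorem IsCATZeroSpace.dist_le_of_glued {X : Type*} [MetricSpace X] (hX : IsCATZeroSpace X)
    {p q r s : X} {p' q' r' s' : EPlane} (hc : IsConvexQuadrilateral p' q' r' s')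
    (hpq : dist p' q' = dist p q) (hqr : dist q' r' = dist q r) (hrs : dist r' s' = dist r s)
    (hsp : dist s' p' = dist s p) (hqs : dist q' s' = dist q s) : dist p r ≤ dist p' r' := by
  obtain ⟨m', hm, hm'⟩ := hc
  rw [segment_eq_image_lineMap] at hm'
  obtain ⟨t, ht, rfl⟩ := hm'
  obtain ⟨γ, h⟩ := hX.exists_isGeodesicPath q s
  have hp := hX.dist_sq_path_le h ht p
  have hr := hX.dist_sq_path_le h ht r
  rw [dist_comm p s, ← hpq, ← hsp, ← hqs, dist_comm s' p', ← dist_sq_lineMap_eq] at hp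
  rw [dist_comm r q, ← hqr, ← hrs, ← hqs, dist_comm q' r', ← dist_sq_lineMap_eq] at hr
  rw [← dist_add_dist_of_mem_segment hm]
  refine (dist_triangle p (γ t) r).trans (add_le_add ?_ ?_)
  · exact le_of_sq_le_sq hp dist_nonneg
  · rw [dist_comm, dist_comm _ r']
    exact le_of_sq_le_sq hr dist_nonneg

theorem exists_convexQuadrilateral_of_reflex {X : Type*} [MetricSpace X] {p q r s : X}
    (hrs : r ≠ s) (hsp : s ≠ p)
    (h : dist r s * (dist q s ^ 2 + dist s p ^ 2 - dist p q ^ 2) +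
      dist s p * (dist q s ^ 2 + dist r s ^ 2 - dist q r ^ 2) < 0) :
    ∃ p' q' r' s' : EPlane, IsConvexQuadrilateral p' q' r' s' ∧ dist p' q' = dist p q ∧
      dist q' r' = dist q r ∧ dist r' s' = dist r s ∧ dist s' p' = dist s p ∧
      dist p r ≤ dist p' r' ∧ dist q s ≤ dist q' s' := by
  have hpr : dist p r ≤ dist s p + dist r s := by
    linarith [dist_triangle p s r, dist_comm p s, dist_comm s r]
  obtain ⟨p', q', r', s', h1, h2, h3, h4, h5, h6, h7⟩ :=
    exists_triangle_of_reflex dist_nonneg dist_nonneg (dist_pos.2 hsp) (dist_pos.2 hrs)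
    (t := dist q s)
    (abs_le.2 ⟨by linarith [dist_triangle s q p, dist_comm s q, dist_comm q p],
      by linarith [dist_triangle p s q, dist_comm p s, dist_comm s q]⟩)
    (abs_le.2 ⟨by linarith [dist_triangle r q s, dist_comm r q],
      by linarith [dist_triangle q s r, dist_comm r s]⟩)
    (by linarith [dist_triangle p r q, dist_comm r q])
    (by linarith [dist_triangle q p r, dist_comm q p]) h
  exact ⟨p', q', r', s', ⟨s', h1, right_mem_segment ℝ q' s'⟩, h2, h3, h4, h5, by linarith, h7⟩

/-- The four-point condition: a quadrilateral in a CAT(0) space has a convex comparison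
quadrilateral in the plane, with the same sides and with diagonals that are at least as long. -/
theorem IsCATZeroSpace.exists_convexQuadrilateral {X : Type*} [MetricSpace X]
    (hX : IsCATZeroSpace X) {p q r s : X} (hpq : p ≠ q) (hqr : q ≠ r) (hrs : r ≠ s) (hsp : s ≠ p) :
    ∃ p' q' r' s' : EPlane, IsConvexQuadrilateral p' q' r' s' ∧ dist p' q' = dist p q ∧
      dist q' r' = dist q r ∧ dist r' s' = dist r s ∧ dist s' p' = dist s p ∧
      dist p r ≤ dist p' r' ∧ dist q s ≤ dist q' s' := by
  by_cases hs : dist r s * (dist q s ^ 2 + dist s p ^ 2 - dist p q ^ 2) +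
      dist s p * (dist q s ^ 2 + dist r s ^ 2 - dist q r ^ 2) < 0
  · exact exists_convexQuadrilateral_of_reflex hrs hsp hs
  by_cases hq : dist q r * (dist q s ^ 2 + dist p q ^ 2 - dist s p ^ 2) +
      dist p q * (dist q s ^ 2 + dist q r ^ 2 - dist r s ^ 2) < 0
  · obtain ⟨p', s', r', q', ⟨m, h1, h1'⟩, h2, h3, h4, h5, h6, h7⟩ :=
      exists_convexQuadrilateral_of_reflex (p := p) (q := s) (r := r) (s := q) hqr.symm hpq.symm
        (by simpa only [dist_comm r q, dist_comm s q, dist_comm q p, dist_comm p s,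
          dist_comm s r] using hq)
    refine ⟨p', q', r', s', ⟨m, h1, by rwa [segment_symm]⟩, ?_, ?_, ?_, ?_, h6, ?_⟩
    · rw [dist_comm, h5, dist_comm]
    · rw [dist_comm, h4, dist_comm]
    · rw [dist_comm, h3, dist_comm]
    · rw [dist_comm, h2, dist_comm]
    · rwa [dist_comm, dist_comm q']
  -- No reflex angle: the glued comparison triangles form a convex quadrilateral.
  suffices ∃ p' q' r' s' : EPlane, IsConvexQuadrilateral p' q' r' s' ∧ dist p' q' = dist p q ∧
      dist q' r' = dist q r ∧ dist r' s' = dist r s ∧ dist s' p' = dist s p ∧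
      dist q' s' = dist q s by
    obtain ⟨p', q', r', s', h1, h2, h3, h4, h5, h6⟩ := this
    exact ⟨p', q', r', s', h1, h2, h3, h4, h5, hX.dist_le_of_glued h1 h2 h3 h4 h5 h6, h6.ge⟩
  have hP := dist_pos.2 hpq
  have hQ := dist_pos.2 hqr
  have hb := dist_pos.2 hrs
  have ha := dist_pos.2 hsp
  have i1 := dist_triangle p q s
  have i2 := dist_triangle s p q
  have i3 := dist_triangle q s p
  have i4 := dist_triangle q r s
  have i5 := dist_triangle r s q
  have i6 := dist_triangle s q r
  rw [dist_comm p s] at i1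
  rw [dist_comm s q] at i2 i5 i6
  rw [dist_comm q p] at i3
  rw [dist_comm r q] at i5
  rw [dist_comm s r] at i6
  rcases (dist_nonneg (x := q) (y := s)).lt_or_eq with ht | ht
  · generalize dist p q = P at *
    generalize dist q r = Q at *
    generalize dist r s = b at *
    generalize dist s p = a at *
    generalize dist q s = t at *
    have vertex : ∀ {P a : ℝ}, a ≤ P + t → t ≤ a + P → P ≤ t + a → 0 < P → 0 < a →
        ∃ x y : ℝ, 0 ≤ y ∧ x ^ 2 + y ^ 2 = P ^ 2 ∧ (t - x) ^ 2 + y ^ 2 = a ^ 2 ∧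
          2 * t * x = P ^ 2 + t ^ 2 - a ^ 2 := by
      intro P a j1 j2 j3 hP ha
      set x : ℝ := (P ^ 2 + t ^ 2 - a ^ 2) / (2 * t) with hx
      have hxe : 2 * t * x = P ^ 2 + t ^ 2 - a ^ 2 := by rw [hx]; field_simp
      have k1 : x ≤ P := by
        have : 2 * t * x ≤ 2 * t * P := by nlinarith
        exact le_of_mul_le_mul_left this (by positivity)
      have k2 : -P ≤ x := by
        have : 2 * t * (-P) ≤ 2 * t * x := by nlinarith
        exact le_of_mul_le_mul_left this (by positivity)
      have hy : 0 ≤ P ^ 2 - x ^ 2 := by nlinarith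
      exact ⟨x, √(P ^ 2 - x ^ 2), Real.sqrt_nonneg _, by rw [Real.sq_sqrt hy]; ring,
        by rw [Real.sq_sqrt hy]; linarith, hxe⟩
    obtain ⟨x₁, y₁, hy₁, h1, h3, e1⟩ := vertex i1 (by linarith) i3 hP ha
    obtain ⟨x₂, y₂, hy₂, h2, h4, e2⟩ := vertex (by linarith) (by linarith) (by linarith) hQ hb
    have g1 : 0 ≤ Q * x₁ + P * x₂ := by
      have : 0 ≤ 2 * t * (Q * x₁ + P * x₂) := by nlinarith
      exact nonneg_of_mul_nonneg_right this (by positivity)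
    have g2 : 0 ≤ b * (t - x₁) + a * (t - x₂) := by
      have : 0 ≤ 2 * t * (b * (t - x₁) + a * (t - x₂)) := by nlinarith
      exact nonneg_of_mul_nonneg_right this (by positivity)
    obtain ⟨u, hu, k1, k2, k3⟩ :=
      exists_crossing ht.le hP hQ ha hb hy₁ hy₂ h1 h2 h3 h4 g1 g2
    refine ⟨!₂[x₁, y₁], !₂[0, 0], !₂[x₂, -y₂], !₂[t, 0],
      ⟨AffineMap.lineMap !₂[x₁, y₁] !₂[x₂, -y₂] u, ?_, ?_⟩, ?_, ?_, ?_, ?_, ?_⟩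
    · rw [segment_eq_image_lineMap]; exact ⟨u, hu, rfl⟩
    · rw [segment_eq_image_lineMap, EPlane.lineMap_mk, k1]
      refine ⟨((1 - u) * x₁ + u * x₂) / t, ⟨by positivity, (div_le_one ht).2 k3⟩, ?_⟩
      rw [EPlane.lineMap_mk]
      refine EPlane.mk_congr ?_ ?_
      · field_simp; ring
      · simp
    · exact EPlane.dist_mk_eq hP.le (by linarith)
    · exact EPlane.dist_mk_eq hQ.le (by linarith)
    · exact EPlane.dist_mk_eq hb.le (by linarith)
    · exact EPlane.dist_mk_eq ha.le (by linarith)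
    · exact EPlane.dist_mk_eq ht.le (by ring)
  · -- Here `q = s`, and `p'`, `r'` may be placed on opposite sides of `q' = s'` on a line.
    refine ⟨!₂[-dist p q, 0], !₂[0, 0], !₂[dist q r, 0], !₂[0, 0],
      ⟨!₂[0, 0], ?_, left_mem_segment ℝ _ _⟩, ?_, ?_, ?_, ?_, ?_⟩
    · rw [segment_eq_image_lineMap]
      refine ⟨dist p q / (dist p q + dist q r), ⟨by positivity,
        (div_le_one (by positivity)).2 (by linarith)⟩, ?_⟩
      rw [EPlane.lineMap_mk]
      refine EPlane.mk_congr ?_ ?_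
      · field_simp; ring
      · simp
    · exact EPlane.dist_mk_eq hP.le (by ring)
    · exact EPlane.dist_mk_eq hQ.le (by ring)
    · have : dist q r = dist r s := by linarith
      exact EPlane.dist_mk_eq hb.le (by rw [this]; ring)
    · have : dist p q = dist s p := by linarith
      exact EPlane.dist_mk_eq ha.le (by rw [this]; ring)
    · exact EPlane.dist_mk_eq ht.le (by rw [← ht]; ring)

/-! ### Comparison angles -/

theorem comparisonAngle_eq_arccos {X : Type*} [MetricSpace X] (x y z : X) :
    comparisonAngle x y z =
      Real.arccos ((dist x y ^ 2 + dist x z ^ 2 - dist y z ^ 2) / 2 / (dist x y * dist x z)) := by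
  obtain ⟨⟨a, b, c⟩, h⟩ := exists_comparisonTriangle x y z
  rw [comparisonAngle_eq h]
  unfold EuclideanGeometry.angle InnerProductGeometry.angle
  rw [real_inner_eq_norm_mul_self_add_norm_mul_self_sub_norm_sub_mul_self_div_two]
  simp only [vsub_eq_sub, sub_sub_sub_cancel_right, ← dist_eq_norm, dist_comm b a, ← sq]
  rw [h.1, h.2.1, h.2.2, dist_comm z x]

theorem angle_eq_comparisonAngle (x y z : EPlane) :
    EuclideanGeometry.angle y x z = comparisonAngle x y z :=
  (comparisonAngle_eq ⟨rfl, rfl, rfl⟩).symm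

theorem comparisonAngle_cos_mem_Icc {X : Type*} [MetricSpace X] {x y z : X} (hy : x ≠ y)
    (hz : x ≠ z) : (dist x y ^ 2 + dist x z ^ 2 - dist y z ^ 2) / 2 / (dist x y * dist x z) ∈
      Set.Icc (-1 : ℝ) 1 := by
  have h1 := dist_pos.2 hy
  have h2 := dist_pos.2 hz
  have h3 := dist_triangle_left y z x
  have h4 := dist_triangle x y z
  have h5 := dist_triangle x z y
  rw [dist_comm z y] at h5
  constructor
  · rw [le_div_iff₀ (by positivity)]; nlinarith [dist_nonneg (x := y) (y := z)]
  · rw [div_le_iff₀ (by positivity)]; nlinarith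

/-- With the adjacent sides fixed, the comparison angle is monotone in the opposite side. -/
theorem comparisonAngle_le_of_dist_le {X Y : Type*} [MetricSpace X] [MetricSpace Y] {x y z : X}
    {x' y' z' : Y} (h1 : dist x' y' = dist x y) (h2 : dist x' z' = dist x z)
    (h : dist y z ≤ dist y' z') : comparisonAngle x y z ≤ comparisonAngle x' y' z' := by
  rw [comparisonAngle_eq_arccos, comparisonAngle_eq_arccos, h1, h2]
  apply Real.arccos_le_arccos
  gcongr

theorem dist_eq_of_comparisonAngle_eq {X Y : Type*} [MetricSpace X] [MetricSpace Y] {x y z : X}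
    {x' y' z' : Y} (hy : x ≠ y) (hz : x ≠ z) (h1 : dist x' y' = dist x y)
    (h2 : dist x' z' = dist x z) (h : comparisonAngle x y z = comparisonAngle x' y' z') :
    dist y' z' = dist y z := by
  have hy0 := dist_pos.2 hy
  have hz0 := dist_pos.2 hz
  have i1 := comparisonAngle_cos_mem_Icc hy hz
  have i2 := comparisonAngle_cos_mem_Icc (x := x') (y := y') (z := z')
    (dist_pos.1 (h1 ▸ hy0)) (dist_pos.1 (h2 ▸ hz0))
  rw [comparisonAngle_eq_arccos, comparisonAngle_eq_arccos] at h
  have h3 := Real.arccos_injOn i1 i2 h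
  rw [h1, h2, div_left_inj' (by positivity), div_left_inj' two_ne_zero] at h3
  exact (sq_eq_sq₀ dist_nonneg dist_nonneg).1 (by linarith)

/-- The angle sum of a quadrilateral, possibly not planar, is at most `2π`: cut it along a diagonal
and apply the triangle inequality for angles at both ends of the diagonal. -/
theorem angle_sum_quadrilateral_le {V P : Type*} [NormedAddCommGroup V] [InnerProductSpace ℝ V]
    [MetricSpace P] [NormedAddTorsor V P] {p q r s : P} (hpq : p ≠ q) (hqr : q ≠ r) :
    EuclideanGeometry.angle s p q + EuclideanGeometry.angle p q r + EuclideanGeometry.angle q r s +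
      EuclideanGeometry.angle r s p ≤ 2 * Real.pi := by
  have h1 := EuclideanGeometry.angle_add_angle_add_angle_eq_pi s hpq
  have h2 := EuclideanGeometry.angle_add_angle_add_angle_eq_pi s hqr.symm
  have h3 := EuclideanGeometry.angle_le_angle_add_angle q p s r
  have h4 := EuclideanGeometry.angle_le_angle_add_angle s r q p
  rw [EuclideanGeometry.angle_comm q p s, EuclideanGeometry.angle_comm p s q,
    EuclideanGeometry.angle_comm s q p] at h1
  rw [EuclideanGeometry.angle_comm r s q] at h2
  rw [EuclideanGeometry.angle_comm r s q] at h4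
  linarith

/-- Four points of a CAT(0) space whose comparison angles add up to at least `2π` are isometric to
the vertices of a convex quadrilateral in the plane, and the sum is equal to `2π`. -/
theorem IsCATZeroSpace.exists_isometric_convexQuadrilateral {X : Type*} [MetricSpace X]
    (hX : IsCATZeroSpace X) {p q r s : X} (hpq : p ≠ q) (hqr : q ≠ r) (hrs : r ≠ s) (hsp : s ≠ p)
    (hsum : 2 * Real.pi ≤ comparisonAngle p s q + comparisonAngle q p r +
      comparisonAngle r q s + comparisonAngle s r p) :
    comparisonAngle p s q + comparisonAngle q p r + comparisonAngle r q s +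
        comparisonAngle s r p = 2 * Real.pi ∧
      ∃ p' q' r' s' : EPlane, IsConvexQuadrilateral p' q' r' s' ∧ dist p' q' = dist p q ∧
        dist q' r' = dist q r ∧ dist r' s' = dist r s ∧ dist s' p' = dist s p ∧
        dist p' r' = dist p r ∧ dist q' s' = dist q s := by
  obtain ⟨p', q', r', s', hc, h1, h2, h3, h4, h5, h6⟩ :=
    hX.exists_convexQuadrilateral hpq hqr hrs hsp
  have h1' : dist q' p' = dist q p := by rw [dist_comm, h1, dist_comm]
  have h2' : dist r' q' = dist r q := by rw [dist_comm, h2, dist_comm]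
  have h3' : dist s' r' = dist s r := by rw [dist_comm, h3, dist_comm]
  have h4' : dist p' s' = dist p s := by rw [dist_comm, h4, dist_comm]
  have a1 : comparisonAngle p s q ≤ comparisonAngle p' s' q' :=
    comparisonAngle_le_of_dist_le h4' h1 (by rwa [dist_comm, dist_comm s'])
  have a2 : comparisonAngle q p r ≤ comparisonAngle q' p' r' :=
    comparisonAngle_le_of_dist_le h1' h2 h5
  have a3 : comparisonAngle r q s ≤ comparisonAngle r' q' s' :=
    comparisonAngle_le_of_dist_le h2' h3 h6
  have a4 : comparisonAngle s r p ≤ comparisonAngle s' r' p' :=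
    comparisonAngle_le_of_dist_le h3' h4 (by rwa [dist_comm, dist_comm r'])
  have hle := angle_sum_quadrilateral_le (p := p') (q := q') (r := r') (s := s')
    (dist_pos.1 (h1 ▸ dist_pos.2 hpq)) (dist_pos.1 (h2 ▸ dist_pos.2 hqr))
  simp only [angle_eq_comparisonAngle] at hle
  refine ⟨by linarith, p', q', r', s', hc, h1, h2, h3, h4, ?_, ?_⟩
  · exact dist_eq_of_comparisonAngle_eq hpq.symm hqr h1' h2 (by linarith)
  · exact dist_eq_of_comparisonAngle_eq hqr.symm hrs h2' h3 (by linarith)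

/-! ### Tight pairs -/

/-- An element of `EPlane × X` stands for a point of the plane together with its image in `X`. Two
such pairs are *short* if the distance in `X` is at most the distance in the plane. -/
def IsShort {X : Type*} [MetricSpace X] (P Q : EPlane × X) : Prop :=
  dist P.2 Q.2 ≤ dist P.1 Q.1

/-- Two pairs are *tight* if their distances in `X` and in the plane agree. -/
def IsTight {X : Type*} [MetricSpace X] (P Q : EPlane × X) : Prop :=
  dist P.2 Q.2 = dist P.1 Q.1

section Tight

variable {X : Type*} [MetricSpace X] {P Q R W : EPlane × X} {t : ℝ}

theorem IsTight.isShort (h : IsTight P Q) : IsShort P Q := h.le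

theorem IsTight.symm (h : IsTight P Q) : IsTight Q P := by
  rw [IsTight, dist_comm, h, dist_comm]

theorem IsShort.symm (h : IsShort P Q) : IsShort Q P := by
  rw [IsShort, dist_comm, dist_comm Q.1]; exact h

theorem IsTight.refl (P : EPlane × X) : IsTight P P := by simp [IsTight]

theorem IsShort.eq_of_fst_eq (h : IsShort P Q) (h' : P.1 = Q.1) : P = Q := by
  refine Prod.ext h' (dist_le_zero.1 ?_)
  rwa [IsShort, h', dist_self] at h

theorem IsTight.isDivPoint (hPQ : IsTight P Q) (hPW : IsTight P W) (hWQ : IsTight W Q)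
    (hW : W.1 = AffineMap.lineMap P.1 Q.1 t) (ht : t ∈ Set.Icc (0 : ℝ) 1) :
    IsDivPoint P.2 Q.2 t W.2 := by
  rw [IsDivPoint, hPQ, hPW, hWQ, hW, dist_left_lineMap, dist_lineMap_right,
    Real.norm_of_nonneg ht.1, Real.norm_of_nonneg (sub_nonneg.2 ht.2)]
  exact ⟨rfl, rfl⟩

theorem IsCATZeroSpace.isShort_of_lineMap (hX : IsCATZeroSpace X) (hPQ : IsTight P Q)
    (hPW : IsTight P W) (hWQ : IsTight W Q) (hW : W.1 = AffineMap.lineMap P.1 Q.1 t)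
    (ht : t ∈ Set.Icc (0 : ℝ) 1) (hRP : IsShort R P) (hRQ : IsShort R Q) : IsShort R W := by
  have h := hX.dist_sq_le ht (hPQ.isDivPoint hPW hWQ hW ht) R.2
  have h' := dist_sq_lineMap_eq P.1 Q.1 R.1 t
  rw [← hW] at h'
  have hP : dist R.2 P.2 ^ 2 ≤ dist R.1 P.1 ^ 2 := pow_le_pow_left₀ dist_nonneg hRP 2
  have hQ : dist R.2 Q.2 ^ 2 ≤ dist R.1 Q.1 ^ 2 := pow_le_pow_left₀ dist_nonneg hRQ 2
  rw [hPQ] at h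
  refine le_of_sq_le_sq ?_ dist_nonneg
  rw [h']
  refine h.trans ?_
  have := mul_le_mul_of_nonneg_left hP (sub_nonneg.2 ht.2)
  have := mul_le_mul_of_nonneg_left hQ ht.1
  linarith

/-- The rigidity step on which flatness rests: if `R` is tight to an interior point of a tight
segment and short to both ends, then it is tight to both ends, since the CAT(0)-inequality for the
distance from `R` to the interior point is an equality. -/
theorem IsCATZeroSpace.isTight_of_lineMap (hX : IsCATZeroSpace X) (hPQ : IsTight P Q)
    (hPW : IsTight P W) (hWQ : IsTight W Q) (hW : W.1 = AffineMap.lineMap P.1 Q.1 t)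
    (ht : t ∈ Set.Ioo (0 : ℝ) 1) (hRP : IsShort R P) (hRQ : IsShort R Q) (hRW : IsTight R W) :
    IsTight R P ∧ IsTight R Q := by
  have ht' : t ∈ Set.Icc (0 : ℝ) 1 := Set.Ioo_subset_Icc_self ht
  have h := hX.dist_sq_le ht' (hPQ.isDivPoint hPW hWQ hW ht') R.2
  have h' := dist_sq_lineMap_eq P.1 Q.1 R.1 t
  rw [← hW] at h'
  have hP : dist R.2 P.2 ^ 2 ≤ dist R.1 P.1 ^ 2 := pow_le_pow_left₀ dist_nonneg hRP 2
  have hQ : dist R.2 Q.2 ^ 2 ≤ dist R.1 Q.1 ^ 2 := pow_le_pow_left₀ dist_nonneg hRQ 2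
  rw [hPQ, hRW, h'] at h
  have t0 := ht.1
  have t1 : 0 < 1 - t := sub_pos.2 ht.2
  have mP := mul_le_mul_of_nonneg_left hP t1.le
  have mQ := mul_le_mul_of_nonneg_left hQ t0.le
  constructor
  · refine le_antisymm hRP (le_of_sq_le_sq ?_ dist_nonneg)
    exact le_of_mul_le_mul_left (by linarith) t1
  · refine le_antisymm hRQ (le_of_sq_le_sq ?_ dist_nonneg)
    exact le_of_mul_le_mul_left (by linarith) t0

end Tight

/-! ### Flat segments -/

/-- A segment in the plane, parametrized affinely over `[0, 1]`, together with an isometric map of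
it to `X`. -/
structure IsFlatSegment {X : Type*} [MetricSpace X] (A : ℝ → EPlane × X) : Prop where
  fst_eq : ∀ u, (A u).1 = AffineMap.lineMap (A 0).1 (A 1).1 u
  tight : ∀ u ∈ Set.Icc (0 : ℝ) 1, ∀ v ∈ Set.Icc (0 : ℝ) 1, IsTight (A u) (A v)

section FlatSegment

variable {X : Type*} [MetricSpace X] {A : ℝ → EPlane × X} {P Q Z : EPlane × X}

theorem IsTight.exists_isFlatSegment {γ : ℝ → X} (h : IsTight P Q) (hγ : IsGeodesicPath γ P.2 Q.2) :
    ∃ A : ℝ → EPlane × X, A 0 = P ∧ A 1 = Q ∧ (∀ u, (A u).2 = γ u) ∧ IsFlatSegment A := by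
  refine ⟨fun u => (AffineMap.lineMap P.1 Q.1 u, γ u), Prod.ext (by simp) hγ.1,
    Prod.ext (by simp) hγ.2.1, fun _ => rfl, ⟨fun u => by simp, fun u hu v hv => ?_⟩⟩
  show dist (γ u) (γ v) = dist (AffineMap.lineMap P.1 Q.1 u) (AffineMap.lineMap P.1 Q.1 v)
  rw [hγ.dist_eq hu hv, h, dist_lineMap_lineMap, Real.dist_eq]

theorem IsFlatSegment.fst_lineMap (hA : IsFlatSegment A) (u v t : ℝ) :
    AffineMap.lineMap (A u).1 (A v).1 t = (A (AffineMap.lineMap u v t)).1 := by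
  rw [hA.fst_eq u, hA.fst_eq v, hA.fst_eq (AffineMap.lineMap u v t)]
  simp only [AffineMap.lineMap_apply_module, smul_eq_mul]
  module

theorem IsFlatSegment.fst_eq_lineMap (hA : IsFlatSegment A) {u v w : ℝ} (huv : u < v) :
    (A w).1 = AffineMap.lineMap (A u).1 (A v).1 ((w - u) / (v - u)) := by
  rw [hA.fst_lineMap]
  congr 2
  have : v - u ≠ 0 := (sub_pos.2 huv).ne'
  rw [AffineMap.lineMap_apply_module, smul_eq_mul, smul_eq_mul]
  field_simp
  ring

theorem IsFlatSegment.isShort (hX : IsCATZeroSpace X) (hA : IsFlatSegment A)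
    (h0 : IsShort Z (A 0)) (h1 : IsShort Z (A 1)) {u : ℝ} (hu : u ∈ Set.Icc (0 : ℝ) 1) :
    IsShort Z (A u) :=
  hX.isShort_of_lineMap (hA.tight 0 (by simp) 1 (by simp)) (hA.tight 0 (by simp) u hu)
    (hA.tight u hu 1 (by simp)) (hA.fst_eq u) hu h0 h1

/-- A pair tight to one interior point of a flat segment is tight to all of it. -/
theorem IsFlatSegment.isTight (hX : IsCATZeroSpace X) (hA : IsFlatSegment A)
    (hs : ∀ u ∈ Set.Icc (0 : ℝ) 1, IsShort Z (A u)) {w : ℝ} (hw : w ∈ Set.Ioo (0 : ℝ) 1)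
    (h : IsTight Z (A w)) {u : ℝ} (hu : u ∈ Set.Icc (0 : ℝ) 1) : IsTight Z (A u) := by
  have key : ∀ {u v : ℝ}, u ∈ Set.Icc (0 : ℝ) 1 → v ∈ Set.Icc (0 : ℝ) 1 → u < w → w < v →
      IsTight Z (A u) ∧ IsTight Z (A v) := by
    intro u v hu hv huw hwv
    have hw' := Set.Ioo_subset_Icc_self hw
    have huv := huw.trans hwv
    exact hX.isTight_of_lineMap (hA.tight u hu v hv) (hA.tight u hu w hw') (hA.tight w hw' v hv)
      (hA.fst_eq_lineMap huv) ⟨div_pos (sub_pos.2 huw) (sub_pos.2 huv),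
        (div_lt_one (sub_pos.2 huv)).2 (by linarith)⟩ (hs u hu) (hs v hv) h
  rcases lt_trichotomy u w with huw | rfl | huw
  · exact (key hu (v := 1) (by simp) huw hw.2).1
  · exact h
  · exact (key (u := 0) (by simp) hu hw.1 huw).2

end FlatSegment

/-! ### Flat crosses and the points between their arms -/

/-- Two flat segments, the diagonals of a quadrilateral, which meet in the plane at the parameters
`a` and `b`, and are short to each other. The point where they meet is not a common endpoint. -/
structure IsFlatCross {X : Type*} [MetricSpace X] (A B : ℝ → EPlane × X) (a b : ℝ) : Prop where
  left : IsFlatSegment A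
  right : IsFlatSegment B
  mem_left : a ∈ Set.Icc (0 : ℝ) 1
  mem_right : b ∈ Set.Icc (0 : ℝ) 1
  meet : (A a).1 = (B b).1
  interior : a ∈ Set.Ioo (0 : ℝ) 1 ∨ b ∈ Set.Ioo (0 : ℝ) 1
  short : ∀ u ∈ Set.Icc (0 : ℝ) 1, ∀ v ∈ Set.Icc (0 : ℝ) 1, IsShort (A u) (B v)

/-- `Z` divides a flat segment from `A u` to `B v` in the ratio `t : 1 - t`. -/
structure IsJoinPoint {X : Type*} [MetricSpace X] (A B : ℝ → EPlane × X) (u v t : ℝ)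
    (Z : EPlane × X) : Prop where
  mem_left : u ∈ Set.Icc (0 : ℝ) 1
  mem_right : v ∈ Set.Icc (0 : ℝ) 1
  mem : t ∈ Set.Icc (0 : ℝ) 1
  fst_eq : Z.1 = AffineMap.lineMap (A u).1 (B v).1 t
  tight_left : IsTight Z (A u)
  tight_right : IsTight Z (B v)

section FlatCross

variable {X : Type*} [MetricSpace X] {A B : ℝ → EPlane × X} {a b u v t u' v' t' w : ℝ}
  {Y Z : EPlane × X}

theorem IsFlatCross.symm (h : IsFlatCross A B a b) : IsFlatCross B A b a :=
  ⟨h.right, h.left, h.mem_right, h.mem_left, h.meet.symm, h.interior.symm,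
    fun u hu v hv => (h.short v hv u hu).symm⟩

theorem IsJoinPoint.symm (h : IsJoinPoint A B u v t Z) : IsJoinPoint B A v u (1 - t) Z :=
  ⟨h.mem_right, h.mem_left, ⟨sub_nonneg.2 h.mem.2, by linarith [h.mem.1]⟩,
    by rw [h.fst_eq, AffineMap.lineMap_apply_one_sub], h.tight_right, h.tight_left⟩

/-- The diagonals meet in `X` as well. -/
theorem IsFlatCross.eq (h : IsFlatCross A B a b) : A a = B b :=
  (h.short a h.mem_left b h.mem_right).eq_of_fst_eq h.meet

theorem IsFlatCross.isTight (hX : IsCATZeroSpace X) (h : IsFlatCross A B a b)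
    (hu : u ∈ Set.Icc (0 : ℝ) 1) (hv : v ∈ Set.Icc (0 : ℝ) 1) : IsTight (A u) (B v) := by
  have key : ∀ {A B : ℝ → EPlane × X} {a b u v : ℝ}, IsFlatCross A B a b →
      b ∈ Set.Ioo (0 : ℝ) 1 → u ∈ Set.Icc (0 : ℝ) 1 → v ∈ Set.Icc (0 : ℝ) 1 →
      IsTight (A u) (B v) := fun h hb hu hv =>
    h.right.isTight hX (h.short _ hu) hb (h.eq ▸ h.left.tight _ hu _ h.mem_left) hv
  rcases h.interior with ha | hb
  · exact (key h.symm ha hv hu).symm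
  · exact key h hb hu hv

theorem IsFlatCross.exists_isJoinPoint (hX : IsCATZeroSpace X) (h : IsFlatCross A B a b)
    (hu : u ∈ Set.Icc (0 : ℝ) 1) (hv : v ∈ Set.Icc (0 : ℝ) 1) (ht : t ∈ Set.Icc (0 : ℝ) 1) :
    ∃ Z, IsJoinPoint A B u v t Z := by
  obtain ⟨γ, hγ⟩ := hX.exists_isGeodesicPath (A u).2 (B v).2
  obtain ⟨C, h0, h1, -, hC⟩ := (h.isTight hX hu hv).exists_isFlatSegment hγ
  refine ⟨C t, hu, hv, ht, ?_, ?_, ?_⟩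
  · rw [hC.fst_eq, h0, h1]
  · rw [← h0]; exact hC.tight t ht 0 (by simp)
  · rw [← h1]; exact hC.tight t ht 1 (by simp)

theorem IsJoinPoint.isShort (hX : IsCATZeroSpace X) (h : IsFlatCross A B a b)
    (hZ : IsJoinPoint A B u v t Z) (hA : IsShort Y (A u)) (hB : IsShort Y (B v)) : IsShort Y Z :=
  hX.isShort_of_lineMap (h.isTight hX hZ.mem_left hZ.mem_right) hZ.tight_left.symm hZ.tight_right
    hZ.fst_eq hZ.mem hA hB

theorem IsJoinPoint.isShort_left (hX : IsCATZeroSpace X) (h : IsFlatCross A B a b)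
    (hZ : IsJoinPoint A B u v t Z) (hw : w ∈ Set.Icc (0 : ℝ) 1) : IsShort Z (A w) :=
  (hZ.isShort hX h (h.left.tight w hw u hZ.mem_left).isShort (h.short w hw v hZ.mem_right)).symm

theorem IsJoinPoint.isShort_isJoinPoint (hX : IsCATZeroSpace X) (h : IsFlatCross A B a b)
    (hY : IsJoinPoint A B u' v' t' Y) (hZ : IsJoinPoint A B u v t Z) : IsShort Y Z :=
  hZ.isShort hX h (hY.isShort_left hX h hZ.mem_left) (hY.symm.isShort_left hX h.symm hZ.mem_right)

/-- The points between the arms of a flat cross are tight to the cross. For interior `u` this is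
the rigidity step at `A u`, and the remaining values of `u` follow by continuity. -/
theorem IsJoinPoint.isTight_left (hX : IsCATZeroSpace X) (h : IsFlatCross A B a b)
    (hZ : IsJoinPoint A B u v t Z) (hw : w ∈ Set.Icc (0 : ℝ) 1) : IsTight Z (A w) := by
  refine le_antisymm (hZ.isShort_left hX h hw) ?_
  have hcont : Continuous fun u₁ => (AffineMap.lineMap (A u₁).1 (B v).1 t : EPlane) := by
    have : (fun u₁ => (AffineMap.lineMap (A u₁).1 (B v).1 t : EPlane)) = fun u₁ =>
        AffineMap.lineMap (AffineMap.lineMap (A 0).1 (A 1).1 u₁ : EPlane) (B v).1 t := by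
      funext u₁; rw [h.left.fst_eq]
    rw [this]
    simp only [AffineMap.lineMap_apply_module]
    fun_prop
  -- The values of `u₁` allowed by continuity: at `u₁ = u` the subtracted distance vanishes.
  have hclosed : IsClosed {u₁ : ℝ | dist (AffineMap.lineMap (A u₁).1 (B v).1 t) (A w).1 -
      dist (AffineMap.lineMap (A u₁).1 (B v).1 t) Z.1 ≤ dist Z.2 (A w).2} :=
    isClosed_le ((hcont.dist continuous_const).sub (hcont.dist continuous_const)) continuous_const
  suffices hsub : Set.Ioo (0 : ℝ) 1 ⊆
      {u₁ : ℝ | dist (AffineMap.lineMap (A u₁).1 (B v).1 t) (A w).1 -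
        dist (AffineMap.lineMap (A u₁).1 (B v).1 t) Z.1 ≤ dist Z.2 (A w).2} by
    have hcl := closure_minimal hsub hclosed
    rw [closure_Ioo zero_ne_one] at hcl
    have := hcl hZ.mem_left
    rwa [Set.mem_ofPred_eq, ← hZ.fst_eq, dist_self, sub_zero] at this
  intro u₁ hu₁
  have hu₁' := Set.Ioo_subset_Icc_self hu₁
  obtain ⟨Z₁, hZ₁⟩ := h.exists_isJoinPoint hX hu₁' hZ.mem_right hZ.mem
  have h1 : IsTight Z₁ (A w) :=
    h.left.isTight hX (fun _ hx => hZ₁.isShort_left hX h hx) hu₁ hZ₁.tight_left hw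
  have h2 := hZ₁.isShort_isJoinPoint hX h hZ
  rw [Set.mem_ofPred_eq, ← hZ₁.fst_eq]
  rw [IsTight] at h1
  rw [IsShort] at h2
  linarith [dist_triangle_left Z₁.2 (A w).2 Z.2, dist_triangle Z₁.2 Z.2 (A w).2]

/-- If the segment from `A u` to `A u'` passes through the centre of the cross, then the segment
from `Z` to `A u'` crosses the other diagonal, and the rigidity step applies there. -/
theorem IsFlatCross.isTight_of_crossing (hX : IsCATZeroSpace X) (h : IsFlatCross A B a b)
    (hYA : ∀ w ∈ Set.Icc (0 : ℝ) 1, IsTight Y (A w))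
    (hYB : ∀ w ∈ Set.Icc (0 : ℝ) 1, IsTight Y (B w))
    (hZA : ∀ w ∈ Set.Icc (0 : ℝ) 1, IsTight Z (A w))
    (hZB : ∀ w ∈ Set.Icc (0 : ℝ) 1, IsTight Z (B w)) (hYZ : IsShort Y Z)
    (hv : v ∈ Set.Icc (0 : ℝ) 1) (hu' : u' ∈ Set.Icc (0 : ℝ) 1) (ht : t ∈ Set.Ioo (0 : ℝ) 1)
    (hZ : Z.1 = AffineMap.lineMap (A u).1 (B v).1 t) (hw : w ∈ Set.Ioo (0 : ℝ) 1)
    (hc : (A a).1 = AffineMap.lineMap (A u).1 (A u').1 w) : IsTight Y Z := by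
  obtain ⟨t0, t1⟩ := ht
  obtain ⟨w0, w1⟩ := hw
  have hd : 0 < 1 - w * t := by nlinarith
  -- `Z` has weights `1 - t` at `A u` and `t` at `B v`. Moving from `Z` to `A u'` by `μ` makes the
  -- weights at `A u` and `A u'` proportional to `1 - w` and `w`, those of the centre `A a`; the
  -- point reached divides the segment from the centre to `B v` in the ratio `σ : 1 - σ`.
  set σ : ℝ := t * (1 - w) / (1 - w * t)
  set μ : ℝ := w * (1 - t) / (1 - w * t)
  have hσm : σ ∈ Set.Icc (0 : ℝ) 1 :=
    ⟨div_nonneg (by nlinarith) hd.le, (div_le_one hd).2 (by nlinarith)⟩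
  have hμm : μ ∈ Set.Ioo (0 : ℝ) 1 :=
    ⟨div_pos (by nlinarith) hd, (div_lt_one hd).2 (by nlinarith)⟩
  have hx : AffineMap.lineMap b v σ ∈ Set.Icc (0 : ℝ) 1 :=
    (convex_Icc (0 : ℝ) 1).lineMap_mem h.mem_right hv hσm
  have hW : (B (AffineMap.lineMap b v σ)).1 = AffineMap.lineMap Z.1 (A u').1 μ := by
    rw [← h.right.fst_lineMap, ← h.meet, hc, hZ]
    have kσ : σ * (1 - w * t) = t * (1 - w) := div_mul_cancel₀ _ hd.ne'
    have kμ : μ * (1 - w * t) = w * (1 - t) := div_mul_cancel₀ _ hd.ne'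
    have e1 : (1 - σ) * (1 - w) = (1 - μ) * (1 - t) :=
      mul_right_cancel₀ hd.ne' (by linear_combination (1 - t) * kμ - (1 - w) * kσ)
    have e2 : (1 - σ) * w = μ :=
      mul_right_cancel₀ hd.ne' (by linear_combination -w * kσ - kμ)
    have e3 : σ = (1 - μ) * t :=
      mul_right_cancel₀ hd.ne' (by linear_combination kσ + t * kμ)
    simp only [AffineMap.lineMap_apply_module]
    linear_combination (norm := module) e1 • (A u).1 + e2 • (A u').1 + e3 • (B v).1
  exact (hX.isTight_of_lineMap (hZA u' hu') (hZB _ hx) (h.isTight hX hu' hx).symm hW hμm hYZ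
    (hYA u' hu').isShort (hYB _ hx)).1

/-- Any two points between the arms of a flat cross are tight. -/
theorem IsJoinPoint.isTight (hX : IsCATZeroSpace X) (h : IsFlatCross A B a b)
    (hY : IsJoinPoint A B u' v' t' Y) (hZ : IsJoinPoint A B u v t Z) : IsTight Y Z := by
  have hYA : ∀ w ∈ Set.Icc (0 : ℝ) 1, IsTight Y (A w) := fun w hw => hY.isTight_left hX h hw
  have hYB : ∀ w ∈ Set.Icc (0 : ℝ) 1, IsTight Y (B w) :=
    fun w hw => hY.symm.isTight_left hX h.symm hw
  have hZA : ∀ w ∈ Set.Icc (0 : ℝ) 1, IsTight Z (A w) := fun w hw => hZ.isTight_left hX h hw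
  have hZB : ∀ w ∈ Set.Icc (0 : ℝ) 1, IsTight Z (B w) :=
    fun w hw => hZ.symm.isTight_left hX h.symm hw
  have hYZ := hY.isShort_isJoinPoint hX h hZ
  -- Points of the plane on one of the diagonals are settled.
  have onA : ∀ w ∈ Set.Icc (0 : ℝ) 1, Z.1 = (A w).1 → IsTight Y Z := fun w hw e => by
    rw [(hZA w hw).isShort.eq_of_fst_eq e]; exact hYA w hw
  have onB : ∀ w ∈ Set.Icc (0 : ℝ) 1, Z.1 = (B w).1 → IsTight Y Z := fun w hw e => by
    rw [(hZB w hw).isShort.eq_of_fst_eq e]; exact hYB w hw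
  rcases hZ.mem.1.eq_or_lt with rfl | t0
  · exact onA u hZ.mem_left (by rw [hZ.fst_eq, AffineMap.lineMap_apply_zero])
  rcases hZ.mem.2.eq_or_lt with rfl | t1
  · exact onB v hZ.mem_right (by rw [hZ.fst_eq, AffineMap.lineMap_apply_one])
  have hZ' := hZ.symm
  -- Otherwise the centre is an interior point of one diagonal, whose far end is joined to `Z`.
  have far : ∀ {A : ℝ → EPlane × X} {a u : ℝ}, IsFlatSegment A → a ∈ Set.Ioo (0 : ℝ) 1 → u ≠ a →
      u ∈ Set.Icc (0 : ℝ) 1 → ∃ u' ∈ Set.Icc (0 : ℝ) 1, ∃ w ∈ Set.Ioo (0 : ℝ) 1,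
        (A a).1 = AffineMap.lineMap (A u).1 (A u').1 w := by
    intro A a u hA ha hua hu
    rcases hua.lt_or_gt with hlt | hlt
    · have : u < 1 := hlt.trans ha.2
      exact ⟨1, by simp, _, ⟨div_pos (by linarith) (by linarith),
        (div_lt_one (by linarith)).2 (by linarith [ha.2])⟩, hA.fst_eq_lineMap this⟩
    · have h0 : 0 < u := ha.1.trans hlt
      refine ⟨0, by simp, 1 - (a - 0) / (u - 0), ?_, ?_⟩
      · rw [sub_zero, sub_zero]
        exact ⟨sub_pos.2 ((div_lt_one h0).2 hlt), sub_lt_self _ (div_pos ha.1 h0)⟩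
      · rw [AffineMap.lineMap_apply_one_sub, ← hA.fst_eq_lineMap h0]
  by_cases hu : u = a
  · refine onB (AffineMap.lineMap b v t)
      ((convex_Icc (0 : ℝ) 1).lineMap_mem h.mem_right hZ.mem_right hZ.mem) ?_
    rw [hZ.fst_eq, hu, h.meet, h.right.fst_lineMap]
  by_cases hv : v = b
  · refine onA (AffineMap.lineMap u a t)
      ((convex_Icc (0 : ℝ) 1).lineMap_mem hZ.mem_left h.mem_left hZ.mem) ?_
    rw [hZ.fst_eq, hv, ← h.meet, h.left.fst_lineMap]
  rcases h.interior with ha | hb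
  · obtain ⟨u₁, hu₁, w, hw, hc⟩ := far h.left ha hu hZ.mem_left
    exact h.isTight_of_crossing hX hYA hYB hZA hZB hYZ hZ.mem_right hu₁ ⟨t0, t1⟩ hZ.fst_eq hw hc
  · obtain ⟨v₁, hv₁, w, hw, hc⟩ := far h.right hb hv hZ.mem_right
    exact h.symm.isTight_of_crossing hX hYB hYA hZB hZA hYZ hZ.mem_left hv₁
      ⟨sub_pos.2 t1, sub_lt_self _ t0⟩ hZ'.fst_eq hw hc

end FlatCross

/-! ### The isometry between the convex hulls -/

theorem IsCATZeroSpace.mem_of_isDivPoint {X : Type*} [MetricSpace X] (hX : IsCATZeroSpace X)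
    {C : Set X} (hC : IsGeodesicallyConvex C) {x y w : X} {t : ℝ} (hx : x ∈ C) (hy : y ∈ C)
    (ht : t ∈ Set.Icc (0 : ℝ) 1) (hw : IsDivPoint x y t w) : w ∈ C := by
  obtain ⟨S, ⟨γ, hγ, rfl⟩, hS⟩ := hC x hx y hy
  rw [hX.eq_of_isDivPoint hγ ht hw]
  exact hS ⟨t, ht, rfl⟩

/-- The image of a convex set of the plane under an isometry is geodesically convex. -/
theorem Isometry.isGeodesicallyConvex_range {X : Type*} [MetricSpace X] {K : Set EPlane}
    (hK : Convex ℝ K) {F : K → X} (hF : Isometry F) : IsGeodesicallyConvex (Set.range F) := by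
  rintro _ ⟨x, rfl⟩ _ ⟨y, rfl⟩
  have hm : ∀ t ∈ Set.Icc (0 : ℝ) 1, AffineMap.lineMap (x : EPlane) (y : EPlane) t ∈ K :=
    fun t ht => hK.lineMap_mem x.2 y.2 ht
  classical
  let γ : ℝ → X := fun t =>
    if ht : t ∈ Set.Icc (0 : ℝ) 1 then F ⟨AffineMap.lineMap (x : EPlane) (y : EPlane) t, hm t ht⟩
    else F x
  have hγ : ∀ t (ht : t ∈ Set.Icc (0 : ℝ) 1),
      γ t = F ⟨AffineMap.lineMap (x : EPlane) (y : EPlane) t, hm t ht⟩ := fun t ht => dif_pos ht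
  refine ⟨γ '' Set.Icc 0 1, ⟨γ, ⟨?_, ?_, dist (x : EPlane) y, fun s hs t ht => ?_⟩, rfl⟩, ?_⟩
  · rw [hγ 0 (by simp)]; congr 1; exact Subtype.ext (AffineMap.lineMap_apply_zero _ _)
  · rw [hγ 1 (by simp)]; congr 1; exact Subtype.ext (AffineMap.lineMap_apply_one _ _)
  · rw [hγ s hs, hγ t ht, hF.dist_eq, Subtype.dist_eq, dist_lineMap_lineMap, Real.dist_eq, mul_comm]
  · rintro _ ⟨t, ht, rfl⟩
    rw [hγ t ht]
    exact ⟨_, rfl⟩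

/-- Four points of a CAT(0) space that are isometric to the vertices of a convex quadrilateral span
a flat convex quadrilateral. -/
theorem IsCATZeroSpace.exists_isometryEquiv_geodesicHull {X : Type*} [MetricSpace X]
    (hX : IsCATZeroSpace X) {p q r s : X} (hpq : p ≠ q) (hqr : q ≠ r) (hrs : r ≠ s) (hsp : s ≠ p)
    {p' q' r' s' : EPlane} (hc : IsConvexQuadrilateral p' q' r' s')
    (h1 : dist p' q' = dist p q) (h2 : dist q' r' = dist q r) (h3 : dist r' s' = dist r s)
    (h4 : dist s' p' = dist s p) (h5 : dist p' r' = dist p r) (h6 : dist q' s' = dist q s) :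
    ∃ j : ↥(convexHull ℝ ({p', q', r', s'} : Set EPlane)) ≃ᵢ
        ↥(geodesicHull ({p, q, r, s} : Set X)),
      ∀ v : ↥(convexHull ℝ ({p', q', r', s'} : Set EPlane)),
        ((v : EPlane) = p' → (j v : X) = p) ∧ ((v : EPlane) = q' → (j v : X) = q) ∧
        ((v : EPlane) = r' → (j v : X) = r) ∧ ((v : EPlane) = s' → (j v : X) = s) := by
  obtain ⟨γA, hγA⟩ := hX.exists_isGeodesicPath p r
  obtain ⟨γB, hγB⟩ := hX.exists_isGeodesicPath q s
  obtain ⟨A, A0, A1, hA2, hA⟩ := IsTight.exists_isFlatSegment (P := (p', p)) (Q := (r', r))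
    h5.symm hγA
  obtain ⟨B, B0, B1, hB2, hB⟩ := IsTight.exists_isFlatSegment (P := (q', q)) (Q := (s', s))
    h6.symm hγB
  have i0 : (0 : ℝ) ∈ Set.Icc (0 : ℝ) 1 := by simp
  have i1 : (1 : ℝ) ∈ Set.Icc (0 : ℝ) 1 := by simp
  have t00 : IsTight (A 0) (B 0) := by rw [A0, B0]; exact h1.symm
  have t10 : IsTight (A 1) (B 0) := by rw [A1, B0]; exact IsTight.symm h2.symm
  have t11 : IsTight (A 1) (B 1) := by rw [A1, B1]; exact h3.symm
  have t01 : IsTight (A 0) (B 1) := by rw [A0, B1]; exact IsTight.symm h4.symm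
  have hAseg : segment ℝ p' r' = (fun u => (A u).1) '' Set.Icc 0 1 := by
    rw [segment_eq_image_lineMap]
    exact Set.image_congr fun u _ => by rw [hA.fst_eq, A0, A1]
  have hBseg : segment ℝ q' s' = (fun u => (B u).1) '' Set.Icc 0 1 := by
    rw [segment_eq_image_lineMap]
    exact Set.image_congr fun u _ => by rw [hB.fst_eq, B0, B1]
  obtain ⟨m, hmA, hmB⟩ := hc
  rw [hAseg] at hmA
  rw [hBseg] at hmB
  obtain ⟨a, ha, ham⟩ := hmA
  obtain ⟨b, hb, hbm⟩ := hmB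
  have hmeet : (A a).1 = (B b).1 := ham.trans hbm.symm
  have hcross : IsFlatCross A B a b := by
    refine ⟨hA, hB, ha, hb, hmeet, ?_, fun u hu v hv => ?_⟩
    · -- A common endpoint would make two adjacent vertices equal.
      have n00 : (A 0).1 ≠ (B 0).1 := by
        rw [A0, B0]; exact dist_pos.1 (h1 ▸ dist_pos.2 hpq)
      have n10 : (A 1).1 ≠ (B 0).1 := by
        rw [A1, B0]; exact (dist_pos.1 (h2 ▸ dist_pos.2 hqr)).symm
      have n11 : (A 1).1 ≠ (B 1).1 := by
        rw [A1, B1]; exact dist_pos.1 (h3 ▸ dist_pos.2 hrs)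
      have n01 : (A 0).1 ≠ (B 1).1 := by
        rw [A0, B1]; exact (dist_pos.1 (h4 ▸ dist_pos.2 hsp)).symm
      by_contra hn
      rw [not_or] at hn
      have ends : ∀ {x : ℝ}, x ∈ Set.Icc (0 : ℝ) 1 → x ∉ Set.Ioo (0 : ℝ) 1 → x = 0 ∨ x = 1 := by
        intro x hx hx'
        rcases hx.1.eq_or_lt with e | l
        · exact Or.inl e.symm
        · exact Or.inr (le_antisymm hx.2 (not_lt.1 fun l' => hx' ⟨l, l'⟩))
      rcases ends ha hn.1 with rfl | rfl <;> rcases ends hb hn.2 with rfl | rfl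
      · exact n00 hmeet
      · exact n01 hmeet
      · exact n10 hmeet
      · exact n11 hmeet
    · have k0 := hB.isShort hX t00.isShort t01.isShort hv
      have k1 := hB.isShort hX t10.isShort t11.isShort hv
      exact (hA.isShort hX k0.symm k1.symm hu).symm
  have hull : convexHull ℝ ({p', q', r', s'} : Set EPlane) =
      convexJoin ℝ (segment ℝ p' r') (segment ℝ q' s') := by
    rw [convexJoin_segments, Set.insert_comm q' r']
  have hex : ∀ x : ↥(convexHull ℝ ({p', q', r', s'} : Set EPlane)),
      ∃ Z : EPlane × X, Z.1 = x ∧ ∃ u v t, IsJoinPoint A B u v t Z := by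
    rintro ⟨x, hx⟩
    rw [hull, mem_convexJoin, hAseg, hBseg] at hx
    obtain ⟨_, ⟨u, hu, rfl⟩, _, ⟨v, hv, rfl⟩, hx⟩ := hx
    rw [segment_eq_image_lineMap] at hx
    obtain ⟨t, ht, rfl⟩ := hx
    obtain ⟨Z, hZ⟩ := hcross.exists_isJoinPoint hX hu hv ht
    exact ⟨Z, hZ.fst_eq, u, v, t, hZ⟩
  choose G hG1 hG using hex
  set F : ↥(convexHull ℝ ({p', q', r', s'} : Set EPlane)) → X := fun x => (G x).2 with hFdef
  have hF : Isometry F := Isometry.of_dist_eq fun x y => by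
    obtain ⟨_, _, _, hx⟩ := hG x
    obtain ⟨_, _, _, hy⟩ := hG y
    have := hx.isTight hX hcross hy
    rwa [IsTight, hG1, hG1] at this
  have hjA : ∀ u ∈ Set.Icc (0 : ℝ) 1, IsJoinPoint A B u 0 0 (A u) := fun u hu =>
    ⟨hu, i0, i0, by rw [AffineMap.lineMap_apply_zero], IsTight.refl _, hcross.isTight hX hu i0⟩
  have hjB : ∀ v ∈ Set.Icc (0 : ℝ) 1, IsJoinPoint A B 0 v 1 (B v) := fun v hv =>
    ⟨i0, hv, i1, by rw [AffineMap.lineMap_apply_one], (hcross.isTight hX i0 hv).symm,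
      IsTight.refl _⟩
  have hFv : ∀ (x : ↥(convexHull ℝ ({p', q', r', s'} : Set EPlane))) {u v t : ℝ} {Z : EPlane × X},
      IsJoinPoint A B u v t Z → (x : EPlane) = Z.1 → F x = Z.2 := by
    intro x u v t Z hZ hx
    obtain ⟨_, _, _, hy⟩ := hG x
    have := (hy.isTight hX hcross hZ).isShort.eq_of_fst_eq (by rw [hG1, hx])
    rw [hFdef]
    exact congrArg Prod.snd this
  have hFp : ∀ x : ↥(convexHull ℝ ({p', q', r', s'} : Set EPlane)), (x : EPlane) = p' → F x = p :=
    fun x hx => by rw [hFv x (hjA 0 i0) (by rw [A0, hx]), A0]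
  have hFq : ∀ x : ↥(convexHull ℝ ({p', q', r', s'} : Set EPlane)), (x : EPlane) = q' → F x = q :=
    fun x hx => by rw [hFv x (hjB 0 i0) (by rw [B0, hx]), B0]
  have hFr : ∀ x : ↥(convexHull ℝ ({p', q', r', s'} : Set EPlane)), (x : EPlane) = r' → F x = r :=
    fun x hx => by rw [hFv x (hjA 1 i1) (by rw [A1, hx]), A1]
  have hFs : ∀ x : ↥(convexHull ℝ ({p', q', r', s'} : Set EPlane)), (x : EPlane) = s' → F x = s :=
    fun x hx => by rw [hFv x (hjB 1 i1) (by rw [B1, hx]), B1]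
  have hrange : Set.range F = geodesicHull ({p, q, r, s} : Set X) := by
    apply Set.Subset.antisymm
    · rintro _ ⟨x, rfl⟩ C ⟨-, hC, hsub⟩
      obtain ⟨u, v, t, hZ⟩ := hG x
      have hAC : (A u).2 ∈ C := by
        rw [hA2]
        exact hX.mem_of_isDivPoint hC (hsub (by simp)) (hsub (by simp)) hZ.mem_left
          (hγA.isDivPoint hZ.mem_left)
      have hBC : (B v).2 ∈ C := by
        rw [hB2]
        exact hX.mem_of_isDivPoint hC (hsub (by simp)) (hsub (by simp)) hZ.mem_right
          (hγB.isDivPoint hZ.mem_right)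
      exact hX.mem_of_isDivPoint hC hAC hBC hZ.mem ((hcross.isTight hX hZ.mem_left
        hZ.mem_right).isDivPoint hZ.tight_left.symm hZ.tight_right hZ.fst_eq hZ.mem)
    · refine Set.sInter_subset_of_mem ⟨?_, ?_, ?_⟩
      · have hK : IsCompact (convexHull ℝ ({p', q', r', s'} : Set EPlane)) :=
          (Set.toFinite _).isCompact_convexHull ℝ
        have := isCompact_iff_compactSpace.1 hK
        exact (isCompact_range hF.continuous).isClosed
      · exact hF.isGeodesicallyConvex_range (convex_convexHull ℝ _)
      · have hsub := subset_convexHull ℝ ({p', q', r', s'} : Set EPlane)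
        rintro x (rfl | rfl | rfl | rfl)
        · exact ⟨⟨p', hsub (by simp)⟩, hFp _ rfl⟩
        · exact ⟨⟨q', hsub (by simp)⟩, hFq _ rfl⟩
        · exact ⟨⟨r', hsub (by simp)⟩, hFr _ rfl⟩
        · exact ⟨⟨s', hsub (by simp)⟩, hFs _ rfl⟩
  rw [← hrange]
  exact ⟨hF.isometryEquivOnRange, fun x => ⟨hFp x, hFq x, hFr x, hFs x⟩⟩

theorem mainTheorem5 {X : Type*} [MetricSpace X] (hX : IsCATZeroSpace X) (p q r s : X)
    (hpq : p ≠ q) (hqr : q ≠ r) (hrs : r ≠ s) (hsp : s ≠ p)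
    (hsum : 2 * Real.pi ≤ comparisonAngle p s q + comparisonAngle q p r +
      comparisonAngle r q s + comparisonAngle s r p) :
    comparisonAngle p s q + comparisonAngle q p r +
        comparisonAngle r q s + comparisonAngle s r p = 2 * Real.pi ∧
      ∃ p' q' r' s' : EPlane, IsConvexQuadrilateral p' q' r' s' ∧
        ∃ j : ↥(convexHull ℝ ({p', q', r', s'} : Set EPlane)) ≃ᵢ
            ↥(geodesicHull ({p, q, r, s} : Set X)),
          ∀ v : ↥(convexHull ℝ ({p', q', r', s'} : Set EPlane)),
            ((v : EPlane) = p' → (j v : X) = p) ∧ ((v : EPlane) = q' → (j v : X) = q) ∧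
            ((v : EPlane) = r' → (j v : X) = r) ∧ ((v : EPlane) = s' → (j v : X) = s) := by
  obtain ⟨hsum', p', q', r', s', hc, h1, h2, h3, h4, h5, h6⟩ :=
    hX.exists_isometric_convexQuadrilateral hpq hqr hrs hsp hsum
  exact ⟨hsum', p', q', r', s', hc,
    hX.exists_isometryEquiv_geodesicHull hpq hqr hrs hsp hc h1 h2 h3 h4 h5 h6⟩
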